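/- Let $G$ be a finite nilpotent group such that, for every prime $p$ dividing $|G|$, the Sylow $p$-subgroup of $G$ is neither cyclic nor a generalized quaternion group $Q_{2^k}$ ($k\ge 3$). Let $\mathcal{G}_E(G)$ be the enhanced power graph of $G$: its vertex set is $G$, and two distinct elements $x,y$ are adjacent if and only if $x,y\in\langle w\rangle$ for some $w\in G$. Let $\mathcal{G}_E^{**}(G)$ be the proper enhanced power graph, that is, the induced subgraph obtained from $\mathcal{G}_E(G)$ by deleting all dominating vertices (the vertices adjacent to every other vertex). A total dominating set of a graph $\Gamma=(V,E)$ is a set $D\subseteq V$ such that every vertex of $V$, including those in $D$, has a neighbour in $D$; the strong domination number $\gamma^{\mathrm{strong}}(\Gamma)$ is the minimum cardinality of a total dominating set of $\Gamma$ (and $\infty$ if there is none). 1. If $G$ is a $p$-group with exactly $r$ subgroups of order $p$, and $\mathcal{G}_E^{**}(G)$ possesses a total dominating set, then $\gamma^{\mathrm{strong}}(\mathcal{G}_E^{**}(G))=2r$. 2. If $|G|$ has $m\ge 2$ distinct prime divisors $p_1,\dots,p_m$, so that $G=P_1\times\cdots\times P_m$ with $P_i$ the Sylow $p_i$-subgroup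 of $G$, and $r_i$ is the number of subgroups of order $p_i$ in $P_i$, then $\mathcal{G}_E^{**}(G)$ possesses a total dominating set and $\gamma^{\mathrm{strong}}(\mathcal{G}_E^{**}(G))=\left(\min_{1\le i\le m} r_i\right)+1$. -/

import Mathlib

/-- The enhanced power graph of `G`: distinct `x`, `y` are adjacent iff they lie in a common
cyclic subgroup of `G`. -/
def enhancedPowerGraph (G : Type*) [Group G] : SimpleGraph G where
  Adj x y := x ≠ y ∧ ∃ w : G, x ∈ Subgroup.zpowers w ∧ y ∈ Subgroup.zpowers w
  symm := ⟨fun _ _ h => ⟨h.1.symm, h.2.imp fun _ hw => ⟨hw.2, hw.1⟩⟩⟩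
  loopless := ⟨fun _ h => h.1 rfl⟩

/-- The proper enhanced power graph: the enhanced power graph with all its dominating vertices
(the vertices adjacent to every other vertex, `SimpleGraph.universalVerts`) deleted. -/
def properEnhancedPowerGraph (G : Type*) [Group G] :
    SimpleGraph ↥((enhancedPowerGraph G).universalVertsᶜ) :=
  (enhancedPowerGraph G).induce (enhancedPowerGraph G).universalVertsᶜ

/-- A total (strongly) dominating set: every vertex of the graph, including those of `D`,
has a neighbour in `D`. -/
def IsTotalDominatingSet {V : Type*} (Γ : SimpleGraph V) (D : Set V) : Prop :=
  ∀ u : V, ∃ v ∈ D, Γ.Adj u v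

/-- The strong domination number: the least cardinality of a total dominating set; it is `⊤`
if the graph has no total dominating set. -/
noncomputable def strongDominationNumber {V : Type*} (Γ : SimpleGraph V) : ℕ∞ :=
  ⨅ D : {D : Set V // IsTotalDominatingSet Γ D}, D.1.encard

/-- `G` is a generalized quaternion group `Q_{2^k}` with `k ≥ 3`. Mathlib's `QuaternionGroup n`
has order `4 * n`, so `Q_{2^k}` is `QuaternionGroup (2 ^ (k - 2))`. -/
def IsGeneralizedQuaternion (G : Type*) [Group G] : Prop :=
  ∃ k : ℕ, 3 ≤ k ∧ Nonempty (G ≃* QuaternionGroup (2 ^ (k - 2)))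

/-- The number of subgroups of order `p` of `G`. -/
noncomputable def numSubgroupsOfOrder (p : ℕ) (G : Type*) [Group G] : ℕ :=
  Nat.card {H : Subgroup G // Nat.card H = p}

/-!
Distinct subgroups of a cyclic group have distinct orders. So a non-identity dominating vertex `x`
with `p ∣ orderOf x` makes the subgroup of order `p` in `⟨x⟩` the only one of `G`, and then the
Sylow `p`-subgroups are cyclic or generalized quaternion. Under the hypotheses of the theorem only
the identity is therefore deleted.

For the same reason adjacent vertices contain the same subgroup of order `p`, as soon as both have
order divisible by `p`. In a `p`-group the graph thus falls into `r` blocks, indexed by the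
subgroups of order `p`, and a generator of such a subgroup is adjacent to the rest of its block.
Each block needs two elements of a total dominating set, and two suffice.

If several primes divide the order, elements of coprime order commute and are adjacent. Generators
of the subgroups of order `p` together with one element of another prime order dominate.
Conversely, attach to each vertex `v` a subgroup of prime order in `⟨v⟩`. The subgroups attached to
a total dominating set exhaust those of order `p` for some `p`, since otherwise subgroups missed at
each prime generate a cyclic group whose generators have no neighbour in the set. One more element
is needed because adjacent vertices cannot have different attached subgroups of the same order.

The classification of `p`-groups with at most one subgroup of order `p` uses a maximal normal cyclic
subgroup `⟨a⟩` containing the elements of order `p`, which is its own centralizer. An element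
`b ∉ ⟨a⟩` with `b ^ p ∈ ⟨a⟩` acts on it by `a ↦ a ^ s`. Unless `p = 2` and `s ≡ 3` modulo `4`, the
geometric sum `1 + s + ⋯ + s ^ (p - 1)` is `p` times a unit modulo `p`, and one can correct `b` by
a power of `a` to get an element of order `p` outside `⟨a⟩`, or else `b` commutes with `a`.
So outside `⟨a⟩` there are elements only for `p = 2`, and then they invert `a` and square to the
involution of `⟨a⟩`.
-/

section CyclicNormalSubgroup

variable {G : Type*} [Group G] {a b : G} {s : ℤ} {p : ℕ}

theorem semiconjBy_pow_zpow_pow (h : SemiconjBy b a (a ^ s)) (m : ℕ) :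
    SemiconjBy (b ^ m) a (a ^ s ^ m) := by
  induction m with
  | zero => simp
  | succ m ih => simpa only [pow_succ', zpow_mul] using (h.zpow_right (s ^ m)).mul_left ih

theorem mul_pow_of_semiconjBy_zpow (h : SemiconjBy b a (a ^ s)) (m : ℕ) :
    (a * b) ^ m = a ^ (∑ i ∈ Finset.range m, s ^ i) * b ^ m := by
  induction m with
  | zero => simp
  | succ m ih =>
    calc (a * b) ^ (m + 1)
        = a ^ (∑ i ∈ Finset.range m, s ^ i) * (b ^ m * a) * b := by rw [pow_succ, ih]; group
      _ = a ^ (∑ i ∈ Finset.range (m + 1), s ^ i) * b ^ (m + 1) := by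
        rw [(semiconjBy_pow_zpow_pow h m).eq, Finset.sum_range_succ, zpow_add]; group

theorem exists_semiconjBy_zpow (ha : (Subgroup.zpowers a).Normal) (g : G) :
    ∃ s : ℤ, SemiconjBy g a (a ^ s) := by
  obtain ⟨s, hs⟩ := Subgroup.mem_zpowers_iff.mp (ha.conj_mem a (Subgroup.mem_zpowers a) g)
  exact ⟨s, by rw [hs, SemiconjBy, inv_mul_cancel_right]⟩

theorem normal_zpowers_of_conj_mem (h : ∀ g, g * a * g⁻¹ ∈ Subgroup.zpowers a) :
    (Subgroup.zpowers a).Normal where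
  conj_mem := by
    rintro _ ⟨k, rfl⟩ g
    simpa only [conj_zpow] using Subgroup.zpow_mem _ (h g) k

theorem mem_centralizer_zpowers_iff {g : G} :
    g ∈ Subgroup.centralizer (Subgroup.zpowers a : Set G) ↔ Commute g a := by
  rw [Subgroup.zpowers_eq_closure, Subgroup.centralizer_closure,
    Subgroup.mem_centralizer_singleton_iff, commute_iff_eq]

theorem commute_of_mem_zpowers (h : a ∈ Subgroup.zpowers b) : Commute b a := by
  obtain ⟨k, rfl⟩ := Subgroup.mem_zpowers_iff.mp h
  exact Commute.self_zpow b k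

theorem mem_zpowers_zpow_of_not_dvd [hp : Fact p.Prime] {n : ℕ} (ha : a ^ p ^ n = 1) {v : ℤ}
    (hv : ¬ (p : ℤ) ∣ v) : a ∈ Subgroup.zpowers (a ^ v) := by
  obtain ⟨k, -, hk⟩ := (Nat.dvd_prime_pow hp.out).mp (orderOf_dvd_of_pow_eq_one ha)
  rw [mem_zpowers_zpow_iff, hk, ← Int.isCoprime_iff_gcd_eq_one]
  push_cast
  exact ((Nat.prime_iff_prime_int.mp hp.out).coprime_iff_not_dvd.mpr hv).symm.pow_right

/- Write `b ^ p = a ^ k`. If `p ∤ k`, then `a` is a power of `b ^ p`. If `p ∣ k`, a suitable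
`a ^ j * b` has `p`-th power `a ^ (j * p * u + k) = 1` and hence lies in `⟨a⟩`, a contradiction. -/
theorem mem_zpowers_of_semiconjBy_of_geom_sum [Fact p.Prime] {n : ℕ} (ha : a ^ p ^ n = 1)
    (htors : ∀ x : G, x ^ p = 1 → x ∈ Subgroup.zpowers a) (hb : b ∉ Subgroup.zpowers a)
    (hbp : b ^ p ∈ Subgroup.zpowers a) (h : SemiconjBy b a (a ^ s)) {u : ℤ}
    (hsum : ∑ i ∈ Finset.range p, s ^ i = p * u) (hu : ¬ (p : ℤ) ∣ u) :
    a ∈ Subgroup.zpowers b := by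
  obtain ⟨k, hk⟩ := Subgroup.mem_zpowers_iff.mp hbp
  by_cases hpk : (p : ℤ) ∣ k
  · obtain ⟨k', rfl⟩ := hpk
    obtain ⟨y, hy⟩ := Subgroup.mem_zpowers_iff.mp (mem_zpowers_zpow_of_not_dvd ha hu)
    have hsemiconj : SemiconjBy b (a ^ (-(k' * y))) ((a ^ (-(k' * y))) ^ s) := by
      simpa only [← zpow_mul, mul_comm] using h.zpow_right (-(k' * y))
    have hpow : (a ^ (-(k' * y)) * b) ^ p = 1 :=
      calc (a ^ (-(k' * y)) * b) ^ p
          = ((a ^ u) ^ y) ^ (-(p * k')) * b ^ p := by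
            rw [mul_pow_of_semiconjBy_zpow hsemiconj, hsum]
            simp only [← zpow_mul]
            ring_nf
        _ = 1 := by rw [hy, ← hk, ← zpow_add, neg_add_cancel, zpow_zero]
    exact absurd ((Subgroup.mul_mem_cancel_left _
      (Subgroup.zpow_mem _ (Subgroup.mem_zpowers a) _)).mp (htors _ hpow)) hb
  · have hle : Subgroup.zpowers (a ^ k) ≤ Subgroup.zpowers b := by
      rw [hk, Subgroup.zpowers_le]
      exact Subgroup.npow_mem_zpowers b p
    exact hle (mem_zpowers_zpow_of_not_dvd ha hpk)

end CyclicNormalSubgroup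

theorem exists_geom_sum_eq_prime_mul_not_dvd {p : ℕ} (hp : p.Prime) (hodd : Odd p) {s : ℤ}
    (hs : (p : ℤ) ∣ s - 1) :
    ∃ u : ℤ, ∑ i ∈ Finset.range p, s ^ i = p * u ∧ ¬ (p : ℤ) ∣ u := by
  obtain ⟨t, ht⟩ := hs
  obtain ⟨v, hv⟩ := odd_sq_dvd_geom_sum₂_sub (a := (1 : ℤ)) (b := t) hodd
  have hst : 1 + (p : ℤ) * t = s := by linarith
  simp only [one_pow, mul_one, hst] at hv
  refine ⟨1 + p * v, by linarith, fun hdvd => ?_⟩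
  have hdvd_one : (p : ℤ) ∣ 1 := (Int.dvd_add_left (dvd_mul_right _ _)).mp hdvd
  exact (Nat.prime_iff_prime_int.mp hp).not_dvd_one hdvd_one

section PGroup

variable {G : Type*} [Group G] {p : ℕ}

theorem exists_pow_notMem_pow_mem (hG : IsPGroup p G) {H : Subgroup G} {g : G} (hg : g ∉ H) :
    ∃ k, g ^ p ^ k ∉ H ∧ (g ^ p ^ k) ^ p ∈ H := by
  have hmem : ∃ k, g ^ p ^ k ∈ H := by
    obtain ⟨k, hk⟩ := hG g
    exact ⟨k, hk ▸ one_mem H⟩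
  simp only [← pow_mul, ← pow_succ]
  exact Nat.exists_not_and_succ_of_not_zero_of_exists (by simpa using hg) hmem

variable [Finite G] [Fact p.Prime]

theorem exists_mem_center_orderOf_eq (hG : IsPGroup p G) {N : Subgroup G} [N.Normal]
    (hN : N ≠ ⊥) : ∃ z ∈ N, z ∈ Subgroup.center G ∧ orderOf z = p := by
  have hConj : IsPGroup p (ConjAct G) := hG.of_equiv ConjAct.toConjAct
  have hdvd : p ∣ Nat.card N :=
    (hG.to_subgroup N).card_eq_or_dvd.resolve_left (mt Subgroup.card_eq_one.mp hN)
  have hone : (1 : N) ∈ MulAction.fixedPoints (ConjAct G) N := fun g => smul_one g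
  obtain ⟨x, hx, hne⟩ := hConj.exists_fixed_point_of_prime_dvd_card_of_fixed_point N hdvd hone
  have hcenter : (x : G) ∈ Subgroup.center G := Subgroup.mem_center_iff.mpr fun g =>
    mul_inv_eq_iff_eq_mul.mp (congrArg Subtype.val (hx (ConjAct.toConjAct g)))
  have hx1 : (x : G) ≠ 1 := fun h => hne (Subtype.ext h.symm)
  exact ⟨x ^ (orderOf (x : G) / p), pow_mem x.2 _, pow_mem hcenter _,
    orderOf_pow_orderOf_div (orderOf_pos _).ne' (hG.dvd_orderOf hx1)⟩

theorem exists_mem_pow_mem_commutator_mem (hG : IsPGroup p G) {A C : Subgroup G} [A.Normal]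
    [C.Normal] (hCA : ¬ C ≤ A) :
    ∃ x ∈ C, x ∉ A ∧ x ^ p ∈ A ∧ ∀ g, x⁻¹ * (g * x * g⁻¹) ∈ A := by
  have : (C.map (QuotientGroup.mk' A)).Normal :=
    Subgroup.Normal.map ‹_› _ (QuotientGroup.mk'_surjective A)
  have hne : C.map (QuotientGroup.mk' A) ≠ ⊥ := by
    rwa [Ne, Subgroup.map_eq_bot_iff, QuotientGroup.ker_mk']
  obtain ⟨_, ⟨x, hxC, rfl⟩, hcenter, hord⟩ :=
    exists_mem_center_orderOf_eq (hG.to_quotient A) hne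
  refine ⟨x, hxC, fun hxA => ?_, ?_, fun g => ?_⟩
  · rw [QuotientGroup.mk'_apply, (QuotientGroup.eq_one_iff x).mpr hxA, orderOf_one] at hord
    exact (Fact.out : p.Prime).one_lt.ne hord
  · rw [← QuotientGroup.eq_one_iff, QuotientGroup.mk_pow, ← hord]
    exact pow_orderOf_eq_one _
  · rw [← QuotientGroup.eq]
    exact (mul_inv_eq_iff_eq_mul.mpr (Subgroup.mem_center_iff.mp hcenter g)).symm

theorem exists_normal_zpowers_gt (hG : IsPGroup p G) {a : G} [(Subgroup.zpowers a).Normal]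
    (htors : ∀ x : G, x ^ p = 1 → x ∈ Subgroup.zpowers a) {g : G} (hga : Commute g a)
    (hg : g ∉ Subgroup.zpowers a) :
    ∃ x, (Subgroup.zpowers x).Normal ∧ Subgroup.zpowers a < Subgroup.zpowers x := by
  obtain ⟨x, hxC, hxA, hxp, hcomm⟩ := exists_mem_pow_mem_commutator_mem hG
    (C := Subgroup.centralizer (Subgroup.zpowers a : Set G))
    fun hle => hg (hle (mem_centralizer_zpowers_iff.mpr hga))
  obtain ⟨n, hn⟩ := hG a
  have hax : a ∈ Subgroup.zpowers x :=
    mem_zpowers_of_semiconjBy_of_geom_sum (s := 1) (u := 1) hn htors hxA hxp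
      (by rw [zpow_one]; exact mem_centralizer_zpowers_iff.mp hxC) (by simp)
      (Nat.prime_iff_prime_int.mp Fact.out).not_dvd_one
  have hle : Subgroup.zpowers a ≤ Subgroup.zpowers x := Subgroup.zpowers_le.mpr hax
  refine ⟨x, normal_zpowers_of_conj_mem fun g => ?_, hle, fun hge => hxA ?_⟩
  · exact (Subgroup.mul_mem_cancel_left _ (inv_mem (Subgroup.mem_zpowers x))).mp (hle (hcomm g))
  · exact hge (Subgroup.mem_zpowers x)

end PGroup

/-- The set of subgroups of order `p`, of which `numSubgroupsOfOrder p G` is the cardinality. -/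
def subgroupsOfOrder (p : ℕ) (G : Type*) [Group G] : Set (Subgroup G) :=
  {H | Nat.card H = p}

/-- `⟨a⟩` is a normal subgroup that is its own centralizer and contains all elements of order `p`.
In a finite `p`-group with at most one subgroup of order `p` such an `a` exists, and it controls
the structure of the whole group. -/
structure IsSelfCentralizingGenerator {G : Type*} [Group G] (p : ℕ) (a : G) : Prop where
  normal : (Subgroup.zpowers a).Normal
  mem_of_commute : ∀ ⦃g⦄, Commute g a → g ∈ Subgroup.zpowers a
  mem_of_pow_eq_one : ∀ ⦃g⦄, g ^ p = 1 → g ∈ Subgroup.zpowers a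

theorem zpowers_eq_of_orderOf_eq {G : Type*} [Group G] {p : ℕ}
    (h : (subgroupsOfOrder p G).Subsingleton) {x y : G} (hx : orderOf x = p)
    (hy : orderOf y = p) : Subgroup.zpowers x = Subgroup.zpowers y :=
  h ((Nat.card_zpowers x).trans hx) ((Nat.card_zpowers y).trans hy)

theorem eq_of_orderOf_eq_two {G : Type*} [Group G] (h : (subgroupsOfOrder 2 G).Subsingleton)
    {x y : G} (hx : orderOf x = 2) (hy : orderOf y = 2) : x = y := by
  have hxy : x ∈ Subgroup.zpowers y :=
    zpowers_eq_of_orderOf_eq h hx hy ▸ Subgroup.mem_zpowers x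
  have hy2 : y ^ 2 = 1 := hy ▸ pow_orderOf_eq_one y
  obtain ⟨k, rfl⟩ := Subgroup.mem_zpowers_iff.mp hxy
  rcases Int.even_or_odd' k with ⟨j, rfl | rfl⟩
  · rw [zpow_mul, zpow_ofNat, hy2, one_zpow, orderOf_one] at hx
    exact absurd hx (by decide)
  · rw [zpow_add_one, zpow_mul, zpow_ofNat, hy2, one_zpow, one_mul]

theorem exists_isSelfCentralizingGenerator {G : Type*} [Group G] [Finite G] {p : ℕ}
    [Fact p.Prime] (hG : IsPGroup p G) (h : (subgroupsOfOrder p G).Subsingleton) :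
    ∃ a : G, IsSelfCentralizingGenerator p a := by
  let S : Set G := {c | (Subgroup.zpowers c).Normal ∧ ∀ x : G, x ^ p = 1 → x ∈ Subgroup.zpowers c}
  have hS : S.Nonempty := by
    rcases subsingleton_or_nontrivial G with _ | _
    · exact ⟨1, inferInstance, fun x _ => Subsingleton.elim 1 x ▸ one_mem _⟩
    obtain ⟨z, -, hz, hzp⟩ := exists_mem_center_orderOf_eq hG (N := ⊤) top_ne_bot
    refine ⟨z, normal_zpowers_of_conj_mem fun g => ?_, fun x hx => ?_⟩
    · rw [Subgroup.mem_center_iff.mp hz g, mul_inv_cancel_right]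
      exact Subgroup.mem_zpowers z
    · rcases eq_or_ne x 1 with rfl | hx1
      · exact one_mem _
      · exact zpowers_eq_of_orderOf_eq h (orderOf_eq_prime hx hx1) hzp ▸ Subgroup.mem_zpowers x
  obtain ⟨a, ⟨hnormal, htors⟩, hmax⟩ := S.toFinite.exists_maximalFor Subgroup.zpowers S hS
  refine ⟨a, hnormal, fun g hga => ?_, htors⟩
  by_contra hg
  obtain ⟨x, hx, hlt⟩ := exists_normal_zpowers_gt hG htors hga hg
  exact hlt.not_ge (hmax ⟨hx, fun y hy => hlt.le (htors y hy)⟩ hlt.le)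

namespace IsSelfCentralizingGenerator

variable {G : Type*} [Group G] {a b : G} {s : ℤ}

section

variable {p : ℕ}

theorem ne_one (ha : IsSelfCentralizingGenerator p a) (hb : b ∉ Subgroup.zpowers a) : a ≠ 1 := by
  rintro rfl
  exact hb (ha.mem_of_commute (Commute.one_right b))

variable [Fact p.Prime]

theorem dvd_sub_one (hG : IsPGroup p G) (ha1 : a ≠ 1) (hbp : b ^ p ∈ Subgroup.zpowers a)
    (h : SemiconjBy b a (a ^ s)) : (p : ℤ) ∣ s - 1 := by
  have hpow : a ^ (s ^ p - 1) = 1 := by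
    rw [zpow_sub_one, mul_inv_eq_one]
    exact mul_right_cancel
      ((semiconjBy_pow_zpow_pow h p).eq.symm.trans (commute_of_mem_zpowers hbp).eq.symm)
  have hdvd : (p : ℤ) ∣ s ^ p - 1 :=
    (Int.natCast_dvd_natCast.mpr (hG.dvd_orderOf ha1)).trans
      (orderOf_dvd_iff_zpow_eq_one.mpr hpow)
  rw [← ZMod.intCast_zmod_eq_zero_iff_dvd] at hdvd ⊢
  simpa only [Int.cast_sub, Int.cast_pow, ZMod.pow_card, Int.cast_one] using hdvd

theorem dvd_of_geom_sum_eq (hG : IsPGroup p G) (ha : IsSelfCentralizingGenerator p a)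
    (hb : b ∉ Subgroup.zpowers a) (hbp : b ^ p ∈ Subgroup.zpowers a)
    (h : SemiconjBy b a (a ^ s)) {u : ℤ} (hsum : ∑ i ∈ Finset.range p, s ^ i = p * u) :
    (p : ℤ) ∣ u := by
  by_contra hu
  obtain ⟨n, hn⟩ := hG a
  exact hb (ha.mem_of_commute (commute_of_mem_zpowers
    (mem_zpowers_of_semiconjBy_of_geom_sum hn ha.mem_of_pow_eq_one hb hbp h hsum hu)))

theorem eq_two_of_notMem (hG : IsPGroup p G) (ha : IsSelfCentralizingGenerator p a)
    (hb : b ∉ Subgroup.zpowers a) : p = 2 := by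
  by_contra hp2
  obtain ⟨k, hc, hcp⟩ := exists_pow_notMem_pow_mem hG hb
  obtain ⟨s, h⟩ := exists_semiconjBy_zpow ha.normal (b ^ p ^ k)
  obtain ⟨u, hsum, hu⟩ := exists_geom_sum_eq_prime_mul_not_dvd Fact.out
    ((Fact.out : p.Prime).odd_of_ne_two hp2) (dvd_sub_one hG (ha.ne_one hc) hcp h)
  exact hu (ha.dvd_of_geom_sum_eq hG hc hcp h hsum)

end

theorem emod_four_eq_three (hG : IsPGroup 2 G) (ha : IsSelfCentralizingGenerator 2 a)
    (hb : b ∉ Subgroup.zpowers a) (hb2 : b ^ 2 ∈ Subgroup.zpowers a)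
    (h : SemiconjBy b a (a ^ s)) : s % 4 = 3 := by
  obtain ⟨t, ht⟩ : (2 : ℤ) ∣ s - 1 := dvd_sub_one hG (ha.ne_one hb) hb2 h
  have hsum : ∑ i ∈ Finset.range 2, s ^ i = (2 : ℕ) * (t + 1) := by
    simp only [Finset.sum_range_succ, Finset.sum_range_zero, pow_zero, pow_one]
    push_cast
    linarith
  have hdvd : (2 : ℤ) ∣ t + 1 := ha.dvd_of_geom_sum_eq hG hb hb2 h hsum
  omega

/- Both `s` and `s + orderOf a` describe the action of `b` on `a`, so both are `3` modulo `4`. -/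
theorem four_dvd_orderOf (hG : IsPGroup 2 G) (ha : IsSelfCentralizingGenerator 2 a)
    (hb : b ∉ Subgroup.zpowers a) (hb2 : b ^ 2 ∈ Subgroup.zpowers a) : 4 ∣ orderOf a := by
  obtain ⟨s, h⟩ := exists_semiconjBy_zpow ha.normal b
  have h' : SemiconjBy b a (a ^ (s + orderOf a)) := by
    rwa [zpow_add, zpow_natCast, pow_orderOf_eq_one, mul_one]
  have hs := ha.emod_four_eq_three hG hb hb2 h
  have hs' := ha.emod_four_eq_three hG hb hb2 h'
  omega

/- Otherwise `c ^ 2 ∉ ⟨a⟩` and `c ^ 4 ∈ ⟨a⟩` for some power `c` of `b`, and `c ^ 2` acts on `a` by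
the square of an integer, which is not `3` modulo `4`. -/
theorem sq_mem (hG : IsPGroup 2 G) (ha : IsSelfCentralizingGenerator 2 a) (b : G) :
    b ^ 2 ∈ Subgroup.zpowers a := by
  by_contra hb
  obtain ⟨k, hc, hc2⟩ := exists_pow_notMem_pow_mem hG hb
  rw [pow_right_comm b] at hc hc2
  obtain ⟨s, h⟩ := exists_semiconjBy_zpow ha.normal (b ^ 2 ^ k)
  have hmod : s ^ 2 % 4 = 3 := ha.emod_four_eq_three hG hc hc2 (semiconjBy_pow_zpow_pow h 2)
  rcases Int.even_or_odd' s with ⟨t, rfl | rfl⟩ <;> ring_nf at hmod <;> omega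

theorem orderOf_sq (hG : IsPGroup 2 G) (ha : IsSelfCentralizingGenerator 2 a)
    (hb : b ∉ Subgroup.zpowers a) : orderOf (b ^ 2) = 2 := by
  have hb2 := ha.sq_mem hG b
  obtain ⟨s, h⟩ := exists_semiconjBy_zpow ha.normal b
  obtain ⟨k, hk⟩ := Subgroup.mem_zpowers_iff.mp hb2
  obtain ⟨n, hn⟩ := IsPGroup.iff_orderOf.mp hG a
  have hs := ha.emod_four_eq_three hG hb hb2 h
  obtain ⟨t, rfl⟩ : ∃ t, s = 2 * (2 * t + 1) + 1 := ⟨s / 4, by omega⟩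
  have hfix : a ^ ((2 * (2 * t + 1) + 1) * k) = a ^ k := by
    have hsemiconj : SemiconjBy b (a ^ k) ((a ^ (2 * (2 * t + 1) + 1)) ^ k) := h.zpow_right k
    rw [hk, ← zpow_mul] at hsemiconj
    rw [hk]
    exact mul_right_cancel (hsemiconj.symm.trans (Commute.self_pow b 2))
  have hdvd : (orderOf a : ℤ) ∣ (2 * t + 1) * (2 * k) := by
    rw [orderOf_dvd_iff_zpow_eq_one, ← mul_inv_eq_one.mpr hfix, ← zpow_sub]
    ring_nf
  have hcop : IsCoprime (orderOf a : ℤ) (2 * t + 1) := by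
    rw [hn]
    push_cast
    exact IsCoprime.pow_left ⟨-t, 1, by ring⟩
  refine orderOf_eq_prime ?_ fun hb1 => hb (ha.mem_of_pow_eq_one hb1)
  rw [← hk, ← zpow_natCast, ← zpow_mul, ← orderOf_dvd_iff_zpow_eq_one, mul_comm]
  exact hcop.dvd_of_dvd_mul_left hdvd

/- Both `a * b` and `b` lie outside `⟨a⟩`, so their squares are the unique involution. -/
theorem semiconjBy_inv (hG : IsPGroup 2 G) (ha : IsSelfCentralizingGenerator 2 a)
    (h : (subgroupsOfOrder 2 G).Subsingleton) (hb : b ∉ Subgroup.zpowers a) :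
    SemiconjBy b a a⁻¹ := by
  have hab : a * b ∉ Subgroup.zpowers a := by
    rwa [Subgroup.mul_mem_cancel_left _ (Subgroup.mem_zpowers a)]
  have hsq : (a * b) ^ 2 = b ^ 2 :=
    eq_of_orderOf_eq_two h (ha.orderOf_sq hG hab) (ha.orderOf_sq hG hb)
  have haba : a * (b * a) = b :=
    mul_right_cancel (b := b) (by simpa only [pow_two, mul_assoc] using hsq)
  exact eq_inv_mul_of_mul_eq haba

theorem inv_mul_mem (hG : IsPGroup 2 G) (ha : IsSelfCentralizingGenerator 2 a)
    (h : (subgroupsOfOrder 2 G).Subsingleton) (hb : b ∉ Subgroup.zpowers a) {g : G}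
    (hg : g ∉ Subgroup.zpowers a) : b⁻¹ * g ∈ Subgroup.zpowers a :=
  ha.mem_of_commute
    ((ha.semiconjBy_inv hG h hb).inv_symm_left.mul_left (ha.semiconjBy_inv hG h hg))

end IsSelfCentralizingGenerator

theorem zpow_cast_intCast {G : Type*} [Group G] {a : G} {n : ℕ} (ha : a ^ n = 1) (k : ℤ) :
    a ^ ((k : ZMod n).cast : ℤ) = a ^ k := by
  rw [ZMod.coe_intCast, Int.emod_def, zpow_sub, zpow_mul, zpow_natCast, ha, one_zpow, inv_one,
    mul_one]

section QuaternionGroup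

variable {G : Type*} [Group G] {m : ℕ} {a b : G}

/-- The homomorphism `QuaternionGroup m →* G` given by a solution `a`, `b` in `G` of the defining
relations of the quaternion group of order `4 * m`: it sends `a i` to `a ^ i` and `xa i` to
`b * a ^ i`, exponents modulo `2 * m` being lifted to integers. -/
def quaternionGroupLift (ha : a ^ (2 * m) = 1) (hsq : b ^ 2 = a ^ m) (h : SemiconjBy b a a⁻¹) :
    QuaternionGroup m →* G :=
  MonoidHom.mk'
    (fun
      | .a i => a ^ (i.cast : ℤ)
      | .xa i => b * a ^ (i.cast : ℤ)) <| by
    have hcomm (k : ℤ) : a ^ k * b = b * a ^ (-k) := by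
      rw [(h.zpow_right (-k)).eq, inv_zpow', neg_neg]
    have hcast (k : ℤ) : a ^ ((k : ZMod (2 * m)).cast : ℤ) = a ^ k := zpow_cast_intCast ha k
    rintro (i | i) (j | j) <;> obtain ⟨k, rfl⟩ := ZMod.intCast_surjective i <;>
      obtain ⟨l, rfl⟩ := ZMod.intCast_surjective j
    · simp only [QuaternionGroup.a_mul_a, ← Int.cast_add, hcast, zpow_add]
    · simp only [QuaternionGroup.a_mul_xa, ← Int.cast_sub, hcast]
      rw [← mul_assoc, hcomm, mul_assoc, ← zpow_add, neg_add_eq_sub]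
    · simp only [QuaternionGroup.xa_mul_a, ← Int.cast_add, hcast, zpow_add, mul_assoc]
    · simp only [QuaternionGroup.xa_mul_xa, ← Int.cast_natCast (R := ZMod (2 * m)) m,
        ← Int.cast_add, ← Int.cast_sub, hcast]
      calc a ^ ((m : ℤ) + l - k) = a ^ m * a ^ (-k) * a ^ l := by
            rw [← zpow_natCast, ← zpow_add, ← zpow_add]
            congr 1
            ring
        _ = b * (b * a ^ (-k)) * a ^ l := by rw [← hsq, pow_two, mul_assoc b b]
        _ = b * a ^ k * (b * a ^ l) := by rw [← hcomm]; simp only [mul_assoc]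

theorem quaternionGroupLift_a (ha : a ^ (2 * m) = 1) (hsq : b ^ 2 = a ^ m)
    (h : SemiconjBy b a a⁻¹) (k : ℤ) : quaternionGroupLift ha hsq h (.a k) = a ^ k :=
  zpow_cast_intCast ha k

theorem quaternionGroupLift_xa (ha : a ^ (2 * m) = 1) (hsq : b ^ 2 = a ^ m)
    (h : SemiconjBy b a a⁻¹) (k : ℤ) : quaternionGroupLift ha hsq h (.xa k) = b * a ^ k :=
  congrArg (b * ·) (zpow_cast_intCast ha k)

theorem quaternionGroupLift_injective (ha : orderOf a = 2 * m) (hsq : b ^ 2 = a ^ m)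
    (h : SemiconjBy b a a⁻¹) (hb : b ∉ Subgroup.zpowers a) :
    Function.Injective (quaternionGroupLift (ha ▸ pow_orderOf_eq_one a) hsq h) := by
  rw [injective_iff_map_eq_one]
  rintro (i | i) hi <;> obtain ⟨k, rfl⟩ := ZMod.intCast_surjective i
  · rw [quaternionGroupLift_a, ← orderOf_dvd_iff_zpow_eq_one, ha] at hi
    rw [(ZMod.intCast_zmod_eq_zero_iff_dvd k (2 * m)).mpr hi, QuaternionGroup.a_zero]
  · rw [quaternionGroupLift_xa] at hi
    refine absurd ?_ hb
    rw [eq_inv_of_mul_eq_one_left hi]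
    exact inv_mem (Subgroup.zpow_mem _ (Subgroup.mem_zpowers a) _)

theorem quaternionGroupLift_surjective (ha : a ^ (2 * m) = 1) (hsq : b ^ 2 = a ^ m)
    (h : SemiconjBy b a a⁻¹) (hcoset : ∀ g ∉ Subgroup.zpowers a, b⁻¹ * g ∈ Subgroup.zpowers a) :
    Function.Surjective (quaternionGroupLift ha hsq h) := by
  intro g
  by_cases hg : g ∈ Subgroup.zpowers a
  · obtain ⟨k, rfl⟩ := Subgroup.mem_zpowers_iff.mp hg
    exact ⟨.a k, quaternionGroupLift_a ..⟩
  · obtain ⟨k, hk⟩ := Subgroup.mem_zpowers_iff.mp (hcoset g hg)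
    exact ⟨.xa k, by rw [quaternionGroupLift_xa, hk, mul_inv_cancel_left]⟩

end QuaternionGroup

theorem isGeneralizedQuaternion_of_notMem_zpowers {G : Type*} [Group G] [Finite G]
    (hG : IsPGroup 2 G) (h : (subgroupsOfOrder 2 G).Subsingleton) {a b : G}
    (ha : IsSelfCentralizingGenerator 2 a) (hb : b ∉ Subgroup.zpowers a) :
    IsGeneralizedQuaternion G := by
  obtain ⟨n, hn⟩ := IsPGroup.iff_orderOf.mp hG a
  have hfour : 2 ^ 2 ∣ 2 ^ n := hn ▸ ha.four_dvd_orderOf hG hb (ha.sq_mem hG b)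
  obtain ⟨l, rfl⟩ := Nat.exists_eq_add_of_le' ((Nat.pow_dvd_pow_iff_le_right one_lt_two).mp hfour)
  have horder : orderOf a = 2 * 2 ^ (l + 1) := hn.trans (pow_succ' 2 (l + 1))
  have hinvol : orderOf (a ^ 2 ^ (l + 1)) = 2 := by
    rw [orderOf_pow_of_dvd (by positivity) ⟨2, by rw [horder, mul_comm]⟩, horder,
      Nat.mul_div_cancel _ (by positivity)]
  have hsq : b ^ 2 = a ^ 2 ^ (l + 1) := eq_of_orderOf_eq_two h (ha.orderOf_sq hG hb) hinvol
  have hinv := ha.semiconjBy_inv hG h hb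
  exact ⟨l + 3, by omega, ⟨(MulEquiv.ofBijective _
    ⟨quaternionGroupLift_injective horder hsq hinv hb,
      quaternionGroupLift_surjective (horder ▸ pow_orderOf_eq_one a) hsq hinv
        fun g hg => ha.inv_mul_mem hG h hb hg⟩).symm⟩⟩

theorem isCyclic_or_isGeneralizedQuaternion {G : Type*} [Group G] [Finite G] {p : ℕ}
    [Fact p.Prime] (hG : IsPGroup p G) (h : (subgroupsOfOrder p G).Subsingleton) :
    IsCyclic G ∨ IsGeneralizedQuaternion G := by
  obtain ⟨a, ha⟩ := exists_isSelfCentralizingGenerator hG h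
  by_cases hcover : ∀ g, g ∈ Subgroup.zpowers a
  · exact Or.inl ⟨a, hcover⟩
  · push Not at hcover
    obtain ⟨b, hb⟩ := hcover
    obtain rfl := ha.eq_two_of_notMem hG hb
    exact Or.inr (isGeneralizedQuaternion_of_notMem_zpowers hG h ha hb)

section SubgroupsOfOrder

variable {G : Type*} [Group G] {p : ℕ}

theorem encard_subgroupsOfOrder [Finite G] :
    (subgroupsOfOrder p G).encard = numSubgroupsOfOrder p G :=
  ENat.card_eq_coe_natCard _

theorem preimage_map_subtype_subgroupsOfOrder (K : Subgroup G) :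
    Subgroup.map K.subtype ⁻¹' subgroupsOfOrder p G = subgroupsOfOrder p K :=
  Set.ext fun H => Eq.congr_left (H.card_map_of_injective K.subtype_injective)

theorem subsingleton_subgroupsOfOrder_subgroup (h : (subgroupsOfOrder p G).Subsingleton)
    (K : Subgroup G) : (subgroupsOfOrder p K).Subsingleton :=
  preimage_map_subtype_subgroupsOfOrder K ▸ h.preimage (Subgroup.map_injective K.subtype_injective)

theorem numSubgroupsOfOrder_subgroup {K : Subgroup G} (hK : ∀ H ∈ subgroupsOfOrder p G, H ≤ K) :
    numSubgroupsOfOrder p K = numSubgroupsOfOrder p G := by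
  change Nat.card (subgroupsOfOrder p K) = Nat.card (subgroupsOfOrder p G)
  rw [← preimage_map_subtype_subgroupsOfOrder]
  refine Nat.card_preimage_of_injective (Subgroup.map_injective K.subtype_injective) fun H hH => ?_
  exact ⟨H.subgroupOf K, Subgroup.map_subgroupOf_eq_of_le (hK H hH)⟩

theorem numSubgroupsOfOrder_sylow [Fact p.Prime] [Finite (Sylow p G)] (P : Sylow p G)
    [(P : Subgroup G).Normal] : numSubgroupsOfOrder p P = numSubgroupsOfOrder p G := by
  refine numSubgroupsOfOrder_subgroup fun H (hH : Nat.card H = p) => ?_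
  have := P.unique_of_normal ‹_›
  obtain ⟨Q, hQ⟩ := (IsPGroup.of_card (hH.trans (pow_one p).symm)).exists_le_sylow
  exact Subsingleton.elim Q P ▸ hQ

end SubgroupsOfOrder

section CyclicSubgroup

theorem eq_of_card_eq_of_isCyclic {G : Type*} [Group G] [Finite G] [IsCyclic G]
    {H K : Subgroup G} (h : Nat.card H = Nat.card K) : H = K := by
  let _ := IsCyclic.commGroup (α := G)
  have heq (L : Subgroup G) (hL : Nat.card L = Nat.card K) :
      L = (powMonoidHom (Nat.card K) : G →* G).ker := by
    refine Subgroup.eq_of_le_of_card_ge (fun x hx => ?_) ?_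
    · exact orderOf_dvd_iff_pow_eq_one.mp (hL ▸ Subgroup.orderOf_dvd_natCard L hx)
    · rw [IsCyclic.card_powMonoidHom_ker, hL]
      exact Nat.gcd_le_right _ Nat.card_pos
  exact (heq H h).trans (heq K rfl).symm

variable {G : Type*} [Group G] {p : ℕ} {x : G}

theorem eq_of_card_eq_of_le_zpowers [Finite G] {H K : Subgroup G} (hH : H ≤ Subgroup.zpowers x)
    (hK : K ≤ Subgroup.zpowers x) (h : Nat.card H = Nat.card K) : H = K := by
  rw [← Subgroup.map_subgroupOf_eq_of_le hH, ← Subgroup.map_subgroupOf_eq_of_le hK]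
  congr 1
  refine eq_of_card_eq_of_isCyclic ?_
  rw [Nat.card_congr (Subgroup.subgroupOfEquivOfLe hH).toEquiv, h,
    Nat.card_congr (Subgroup.subgroupOfEquivOfLe hK).toEquiv]

theorem exists_subgroupsOfOrder_le_zpowers [Finite G] (hp : p ∣ orderOf x) :
    ∃ H : subgroupsOfOrder p G, (H : Subgroup G) ≤ Subgroup.zpowers x :=
  ⟨⟨Subgroup.zpowers (x ^ (orderOf x / p)),
    (Nat.card_zpowers _).trans (orderOf_pow_orderOf_div (orderOf_pos x).ne' hp)⟩,
    Subgroup.zpowers_le.mpr (Subgroup.npow_mem_zpowers x _)⟩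

theorem exists_zpowers_eq_of_card_prime [Fact p.Prime] {H : Subgroup G} (hH : Nat.card H = p) :
    ∃ x, Subgroup.zpowers x = H :=
  H.isCyclic_iff_exists_zpowers_eq_top.mp (isCyclic_of_prime_card hH)

end CyclicSubgroup

section CoprimeOrder

variable {G : Type*} [Group G] {x y : G}

theorem mem_zpowers_mul_left_of_coprime (hxy : Commute x y)
    (h : (orderOf x).Coprime (orderOf y)) : x ∈ Subgroup.zpowers (x * y) := by
  have hpow : x ^ orderOf y = (x * y) ^ orderOf y := by
    rw [hxy.mul_pow, pow_orderOf_eq_one, mul_one]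
  have hle : Subgroup.zpowers (x ^ orderOf y) ≤ Subgroup.zpowers (x * y) :=
    Subgroup.zpowers_le.mpr (hpow ▸ Subgroup.npow_mem_zpowers (x * y) _)
  exact hle (mem_zpowers_pow_iff.mpr h.symm)

theorem mem_zpowers_mul_right_of_coprime (hxy : Commute x y)
    (h : (orderOf x).Coprime (orderOf y)) : y ∈ Subgroup.zpowers (x * y) :=
  hxy.eq ▸ mem_zpowers_mul_left_of_coprime hxy.symm h.symm

variable [Finite G] [hG : Group.IsNilpotent G]

theorem commute_of_coprime_orderOf (h : (orderOf x).Coprime (orderOf y)) : Commute x y := by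
  obtain ⟨e⟩ := (Group.isNilpotent_of_finite_tfae (G := G).out 0 4 rfl rfl).mp hG
  suffices hcomm : Commute (e.symm x) (e.symm y) by simpa using hcomm.map e
  refine funext fun p => funext fun P => ?_
  have : Fact (p : ℕ).Prime := ⟨Nat.prime_of_mem_primeFactors p.2⟩
  let toSylow : G →* P :=
    ((Pi.evalMonoidHom _ P).comp (Pi.evalMonoidHom _ p)).comp e.symm.toMonoidHom
  change Commute (toSylow x) (toSylow y)
  by_cases hx : toSylow x = 1
  · exact hx ▸ Commute.one_left _
  by_cases hy : toSylow y = 1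
  · exact hy ▸ Commute.one_right _
  have hpx := (P.isPGroup'.dvd_orderOf hx).trans (orderOf_map_dvd toSylow x)
  have hpy := (P.isPGroup'.dvd_orderOf hy).trans (orderOf_map_dvd toSylow y)
  exact absurd (Nat.eq_one_of_dvd_coprimes h hpx hpy) (Nat.Prime.one_lt Fact.out).ne'

theorem exists_forall_mem_zpowers {ι : Type*} (s : Finset ι) (g : ι → G)
    (hg : (s : Set ι).Pairwise fun i j => (orderOf (g i)).Coprime (orderOf (g j))) :
    ∃ u : G, orderOf u ∣ ∏ i ∈ s, orderOf (g i) ∧ ∀ i ∈ s, g i ∈ Subgroup.zpowers u := by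
  classical
  induction s using Finset.induction_on with
  | empty => exact ⟨1, by simp, by simp⟩
  | insert i s his ih =>
    rw [Finset.coe_insert, Set.pairwise_insert_of_notMem his] at hg
    obtain ⟨u, hu, hgu⟩ := ih hg.1
    have hcop : (orderOf (g i)).Coprime (orderOf u) :=
      Nat.Coprime.coprime_dvd_right hu (Nat.Coprime.prod_right fun j hj => (hg.2 j hj).1)
    have hcomm := commute_of_coprime_orderOf hcop
    refine ⟨g i * u, ?_, Finset.forall_mem_insert _ _ _ |>.mpr ⟨?_, fun j hj => ?_⟩⟩
    · rw [Finset.prod_insert his]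
      exact hcomm.orderOf_mul_dvd_mul_orderOf.trans (mul_dvd_mul_left _ hu)
    · exact mem_zpowers_mul_left_of_coprime hcomm hcop
    · exact Subgroup.zpowers_le.mpr (mem_zpowers_mul_right_of_coprime hcomm hcop) (hgu j hj)

end CoprimeOrder

namespace enhancedPowerGraph

variable {G : Type*} [Group G] {x y : G}

theorem adj_of_mem_zpowers (hne : x ≠ y) (h : y ∈ Subgroup.zpowers x) :
    (enhancedPowerGraph G).Adj x y :=
  ⟨hne, x, Subgroup.mem_zpowers x, h⟩

theorem one_mem_universalVerts : 1 ∈ (enhancedPowerGraph G).universalVerts :=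
  fun _ hne => (adj_of_mem_zpowers hne.symm (one_mem _)).symm

variable [Finite G]

theorem adj_of_coprime_orderOf [Group.IsNilpotent G] (hx : x ≠ 1)
    (h : (orderOf x).Coprime (orderOf y)) : (enhancedPowerGraph G).Adj x y := by
  have hxy := commute_of_coprime_orderOf h
  refine ⟨?_, x * y, mem_zpowers_mul_left_of_coprime hxy h, mem_zpowers_mul_right_of_coprime hxy h⟩
  rintro rfl
  exact hx (orderOf_eq_one_iff.mp ((Nat.coprime_self _).mp h))

theorem eq_of_adj (h : (enhancedPowerGraph G).Adj x y) {H K : Subgroup G}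
    (hH : H ≤ Subgroup.zpowers x) (hK : K ≤ Subgroup.zpowers y)
    (hcard : Nat.card H = Nat.card K) : H = K := by
  obtain ⟨-, w, hx, hy⟩ := h
  exact eq_of_card_eq_of_le_zpowers (hH.trans (Subgroup.zpowers_le.mpr hx))
    (hK.trans (Subgroup.zpowers_le.mpr hy)) hcard

theorem subsingleton_subgroupsOfOrder_of_mem_universalVerts {p : ℕ} [Fact p.Prime]
    (hx : x ∈ (enhancedPowerGraph G).universalVerts) (hp : p ∣ orderOf x) :
    (subgroupsOfOrder p G).Subsingleton := by
  obtain ⟨⟨C, hC⟩, hCx⟩ := exists_subgroupsOfOrder_le_zpowers hp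
  refine Set.subsingleton_of_forall_eq C fun H (hH : Nat.card H = p) => ?_
  obtain ⟨y, rfl⟩ := exists_zpowers_eq_of_card_prime hH
  rcases eq_or_ne x y with rfl | hxy
  · exact eq_of_card_eq_of_le_zpowers le_rfl hCx (hH.trans hC.symm)
  · exact eq_of_adj (hx hxy).symm le_rfl hCx (hH.trans hC.symm)

theorem universalVerts_eq_singleton_one
    (hSylow : ∀ p ∈ (Nat.card G).primeFactors, ∀ P : Sylow p G,
      ¬ IsCyclic P ∧ ¬ IsGeneralizedQuaternion P) :
    (enhancedPowerGraph G).universalVerts = {1} := by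
  refine Set.eq_singleton_iff_unique_mem.mpr ⟨one_mem_universalVerts, fun x hx => ?_⟩
  by_contra hx1
  obtain ⟨p, hp, hpx⟩ := Nat.exists_prime_and_dvd (mt orderOf_eq_one_iff.mp hx1)
  have := Fact.mk hp
  obtain ⟨P⟩ : Nonempty (Sylow p G) := inferInstance
  have hpG : p ∈ (Nat.card G).primeFactors :=
    Nat.mem_primeFactors.mpr ⟨hp, hpx.trans (orderOf_dvd_natCard x), Nat.card_pos.ne'⟩
  have hsub := subsingleton_subgroupsOfOrder_of_mem_universalVerts hx hpx
  exact (isCyclic_or_isGeneralizedQuaternion P.isPGroup'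
    (subsingleton_subgroupsOfOrder_subgroup hsub P)).elim (hSylow p hpG P).1 (hSylow p hpG P).2

end enhancedPowerGraph

section TotalDomination

theorem encard_range_le {α ι : Type*} (f : ι → α) : (Set.range f).encard ≤ ENat.card ι := by
  rw [← Set.image_univ, ← Set.encard_univ]
  exact Set.encard_image_le f _

/- One of `v`, `w` can be removed from `D` without losing any value in `S`. -/
theorem encard_add_one_le_of_subset_image {α β : Type*} {f : α → β} {S : Set β} {D : Set α}
    (hSD : S ⊆ f '' D) {v w : α} (hv : v ∈ D) (hw : w ∈ D) (hvw : v ≠ w)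
    (hf : f v ∈ S → f w ∈ S → f v = f w) : S.encard + 1 ≤ D.encard := by
  obtain ⟨t, htD, hS⟩ : ∃ t ∈ D, S ⊆ f '' (D \ {t}) := by
    by_cases hwS : f w ∈ S
    · refine ⟨v, hv, fun y hy => ?_⟩
      obtain ⟨u, hu, rfl⟩ := hSD hy
      rcases eq_or_ne u v with rfl | huv
      · exact ⟨w, ⟨hw, hvw.symm⟩, (hf hy hwS).symm⟩
      · exact ⟨u, ⟨hu, huv⟩, rfl⟩
    · refine ⟨w, hw, fun y hy => ?_⟩
      obtain ⟨u, hu, rfl⟩ := hSD hy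
      exact ⟨u, ⟨hu, fun huw => hwS (huw ▸ hy)⟩, rfl⟩
  calc S.encard + 1 ≤ (D \ {t}).encard + 1 := by
        gcongr
        exact (Set.encard_le_encard hS).trans (Set.encard_image_le f _)
    _ = D.encard := Set.encard_sdiff_singleton_add_one htD

variable {V ι : Type*} {Γ : SimpleGraph V} {D : Set V} {π : V → ι} {c : ι → V}

theorem strongDominationNumber_le (hD : IsTotalDominatingSet Γ D) :
    strongDominationNumber Γ ≤ D.encard :=
  iInf_le (fun D : {D : Set V // IsTotalDominatingSet Γ D} => D.1.encard) ⟨D, hD⟩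

theorem IsTotalDominatingSet.two_mul_card_le_encard (hD : IsTotalDominatingSet Γ D)
    (hadj : ∀ ⦃u v⦄, Γ.Adj u v → π u = π v) (hsurj : Function.Surjective π) :
    2 * ENat.card ι ≤ D.encard := by
  choose v hvD hv using fun i => hD (Function.surjInv hsurj i)
  choose w hwD hw using fun i => hD (v i)
  have hπv (i : ι) : π (v i) = i := (hadj (hv i)).symm.trans (Function.surjInv_eq hsurj i)
  have hπw (i : ι) : π (w i) = i := (hadj (hw i)).symm.trans (hπv i)
  have hinj : Function.Injective (Sum.elim v w) := by
    refine Function.Injective.sumElim (Function.LeftInverse.injective hπv)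
      (Function.LeftInverse.injective hπw) fun i j hij => ?_
    obtain rfl : i = j := by rw [← hπv i, hij, hπw]
    exact (hw i).ne hij
  calc 2 * ENat.card ι = ENat.card (ι ⊕ ι) := by rw [ENat.card_sum, two_mul]
    _ ≤ (Set.range (Sum.elim v w)).encard := hinj.encard_range
    _ ≤ D.encard := by
      refine Set.encard_le_encard (Set.range_subset_iff.mpr ?_)
      rintro (i | i)
      exacts [hvD i, hwD i]

theorem strongDominationNumber_le_two_mul_card (hc : ∀ u, u ≠ c (π u) → Γ.Adj u (c (π u)))
    (hd : ∀ i, ∃ v, Γ.Adj (c i) v) : strongDominationNumber Γ ≤ 2 * ENat.card ι := by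
  choose d hd using hd
  have hrange : IsTotalDominatingSet Γ (Set.range (Sum.elim c d)) := fun u => by
    by_cases hu : u = c (π u)
    · refine ⟨d (π u), ⟨Sum.inr (π u), rfl⟩, ?_⟩
      simpa only [← hu] using hd (π u)
    · exact ⟨c (π u), ⟨Sum.inl (π u), rfl⟩, hc u hu⟩
  calc strongDominationNumber Γ ≤ (Set.range (Sum.elim c d)).encard :=
        strongDominationNumber_le hrange
    _ ≤ ENat.card (ι ⊕ ι) := encard_range_le _
    _ = 2 * ENat.card ι := by rw [ENat.card_sum, two_mul]

end TotalDomination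

namespace properEnhancedPowerGraph

variable {G : Type*} [Group G]

theorem val_ne_one (v : ↥((enhancedPowerGraph G).universalVertsᶜ)) : (v : G) ≠ 1 :=
  fun hv => v.2 (hv ▸ enhancedPowerGraph.one_mem_universalVerts)

theorem exists_orderOf_eq_zpowers_eq (hV : (enhancedPowerGraph G).universalVerts = {1}) {p : ℕ}
    [Fact p.Prime] {H : Subgroup G} (hH : Nat.card H = p) :
    ∃ v : ↥((enhancedPowerGraph G).universalVertsᶜ),
      orderOf (v : G) = p ∧ Subgroup.zpowers (v : G) = H := by
  obtain ⟨x, rfl⟩ := exists_zpowers_eq_of_card_prime hH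
  rw [Nat.card_zpowers] at hH
  refine ⟨⟨x, ?_⟩, hH, rfl⟩
  rw [hV, Set.mem_compl_singleton_iff]
  rintro rfl
  exact (Fact.out : p.Prime).one_lt.ne (orderOf_one.symm.trans hH)

variable [Finite G]

theorem exists_le_zpowers_card_prime (v : ↥((enhancedPowerGraph G).universalVertsᶜ)) :
    ∃ H ≤ Subgroup.zpowers (v : G), (Nat.card H).Prime := by
  obtain ⟨p, hp, hpv⟩ := Nat.exists_prime_and_dvd (mt orderOf_eq_one_iff.mp (val_ne_one v))
  obtain ⟨⟨H, hH⟩, hHv⟩ := exists_subgroupsOfOrder_le_zpowers hpv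
  exact ⟨H, hHv, hH ▸ hp⟩

theorem strongDominationNumber_of_isPGroup {p : ℕ} [Fact p.Prime] (hG : IsPGroup p G)
    (hV : (enhancedPowerGraph G).universalVerts = {1})
    (hD : ∃ D, IsTotalDominatingSet (properEnhancedPowerGraph G) D) :
    strongDominationNumber (properEnhancedPowerGraph G) = 2 * (numSubgroupsOfOrder p G : ℕ∞) := by
  choose socle hsocle using fun v : ↥((enhancedPowerGraph G).universalVertsᶜ) =>
    exists_subgroupsOfOrder_le_zpowers (hG.dvd_orderOf (val_ne_one v))
  choose c _ hc using fun H : subgroupsOfOrder p G => exists_orderOf_eq_zpowers_eq hV H.2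
  have hsocle_c (H : subgroupsOfOrder p G) : socle (c H) = H :=
    Subtype.ext (eq_of_card_eq_of_le_zpowers (hsocle (c H)) (hc H).ge
      ((socle (c H)).2.trans H.2.symm))
  rw [← encard_subgroupsOfOrder]
  obtain ⟨D, hD⟩ := hD
  refine le_antisymm (strongDominationNumber_le_two_mul_card (π := socle) (c := c) ?_
      fun H => (hD (c H)).imp fun _ => And.right)
    (le_iInf fun E => E.2.two_mul_card_le_encard (π := socle) ?_
      (Function.RightInverse.surjective hsocle_c))
  · intro u hu
    refine enhancedPowerGraph.adj_of_mem_zpowers (Subtype.coe_ne_coe.mpr hu) (hsocle u ?_)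
    exact (hc (socle u)).le (Subgroup.mem_zpowers _)
  · intro u v huv
    exact Subtype.ext (enhancedPowerGraph.eq_of_adj huv (hsocle u) (hsocle v)
      ((socle u).2.trans (socle v).2.symm))

variable [Group.IsNilpotent G]

theorem adj_of_coprime_orderOf {u v : ↥((enhancedPowerGraph G).universalVertsᶜ)}
    (h : (orderOf (u : G)).Coprime (orderOf (v : G))) : (properEnhancedPowerGraph G).Adj u v :=
  enhancedPowerGraph.adj_of_coprime_orderOf (val_ne_one u) h

theorem strongDominationNumber_le_numSubgroupsOfOrder_add_one
    (hV : (enhancedPowerGraph G).universalVerts = {1}) {p q : ℕ} [hp : Fact p.Prime]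
    [hq : Fact q.Prime] (hpq : p ≠ q) (hpG : p ∣ Nat.card G) (hqG : q ∣ Nat.card G) :
    strongDominationNumber (properEnhancedPowerGraph G) ≤ numSubgroupsOfOrder p G + 1 := by
  choose c hcp hc using fun H : subgroupsOfOrder p G => exists_orderOf_eq_zpowers_eq hV H.2
  obtain ⟨y, hy⟩ := exists_prime_orderOf_dvd_card' q hqG
  obtain ⟨z, hzq, -⟩ := exists_orderOf_eq_zpowers_eq hV ((Nat.card_zpowers y).trans hy)
  have hdom : IsTotalDominatingSet (properEnhancedPowerGraph G) (insert z (Set.range c)) := by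
    intro u
    by_cases hpu : p ∣ orderOf (u : G)
    · obtain ⟨C, hCu⟩ := exists_subgroupsOfOrder_le_zpowers hpu
      rcases eq_or_ne u (c C) with rfl | huc
      · refine ⟨z, Set.mem_insert z _, adj_of_coprime_orderOf ?_⟩
        rwa [hcp, hzq, Nat.coprime_primes hp.out hq.out]
      · refine ⟨c C, Set.mem_insert_of_mem z ⟨C, rfl⟩,
          enhancedPowerGraph.adj_of_mem_zpowers (Subtype.coe_ne_coe.mpr huc) (hCu ?_)⟩
        exact (hc C).le (Subgroup.mem_zpowers _)
    · obtain ⟨x, hx⟩ := exists_prime_orderOf_dvd_card' p hpG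
      refine ⟨c ⟨Subgroup.zpowers x, (Nat.card_zpowers x).trans hx⟩,
        Set.mem_insert_of_mem z ⟨_, rfl⟩, adj_of_coprime_orderOf ?_⟩
      rw [hcp]
      exact (hp.out.coprime_iff_not_dvd.mpr hpu).symm
  calc strongDominationNumber (properEnhancedPowerGraph G)
      ≤ (insert z (Set.range c)).encard := strongDominationNumber_le hdom
    _ ≤ (Set.range c).encard + 1 := Set.encard_insert_le _ _
    _ ≤ (subgroupsOfOrder p G).encard + 1 := by gcongr; exact encard_range_le c
    _ = numSubgroupsOfOrder p G + 1 := by rw [encard_subgroupsOfOrder]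

/- Otherwise choose, for every prime `p`, an element of order `p` generating a subgroup missed by
`f`. These elements lie in a common cyclic group `⟨u⟩`, and a neighbour `v ∈ D` of `u` makes `f v`
one of the missed subgroups. -/
theorem exists_subgroupsOfOrder_subset_image [Nontrivial G]
    (hV : (enhancedPowerGraph G).universalVerts = {1})
    {D : Set ↥((enhancedPowerGraph G).universalVertsᶜ)}
    (hD : IsTotalDominatingSet (properEnhancedPowerGraph G) D)
    {f : ↥((enhancedPowerGraph G).universalVertsᶜ) → Subgroup G}
    (hf : ∀ v, f v ≤ Subgroup.zpowers (v : G)) (hfp : ∀ v, (Nat.card (f v)).Prime) :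
    ∃ p ∈ (Nat.card G).primeFactors, subgroupsOfOrder p G ⊆ f '' D := by
  by_contra! hmissed
  have hgen : ∀ p ∈ (Nat.card G).primeFactors,
      ∃ x : G, orderOf x = p ∧ Subgroup.zpowers x ∉ f '' D := fun p hp => by
    have := Fact.mk (Nat.prime_of_mem_primeFactors hp)
    obtain ⟨H, hH, hHD⟩ := Set.not_subset.mp (hmissed p hp)
    obtain ⟨x, rfl⟩ := exists_zpowers_eq_of_card_prime hH
    exact ⟨x, (Nat.card_zpowers x).symm.trans hH, hHD⟩
  choose! x hx hxD using hgen
  obtain ⟨u, -, hxu⟩ := exists_forall_mem_zpowers (Nat.card G).primeFactors x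
    fun p hp q hq hpq => by
      change (orderOf (x p)).Coprime (orderOf (x q))
      rw [hx p hp, hx q hq]
      exact (Nat.coprime_primes (Nat.prime_of_mem_primeFactors hp)
        (Nat.prime_of_mem_primeFactors hq)).mpr hpq
  have hu : u ∈ (enhancedPowerGraph G).universalVertsᶜ := by
    rw [hV, Set.mem_compl_singleton_iff]
    rintro rfl
    obtain ⟨p, hp⟩ := Nat.nonempty_primeFactors.mpr (Finite.one_lt_card (α := G))
    have hxp : x p = 1 := by simpa using hxu p hp
    rw [← hx p hp, hxp, orderOf_one] at hp
    exact Nat.not_prime_one (Nat.prime_of_mem_primeFactors hp)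
  obtain ⟨v, hvD, huv⟩ := hD ⟨u, hu⟩
  have hp : Nat.card (f v) ∈ (Nat.card G).primeFactors :=
    Nat.mem_primeFactors.mpr ⟨hfp v, (f v).card_subgroup_dvd_card, Nat.card_pos.ne'⟩
  refine hxD _ hp ⟨v, hvD, ?_⟩
  exact (enhancedPowerGraph.eq_of_adj huv (Subgroup.zpowers_le.mpr (hxu _ hp)) (hf v)
    ((Nat.card_zpowers _).trans (hx _ hp))).symm

theorem exists_numSubgroupsOfOrder_add_one_le_encard [Nontrivial G]
    (hV : (enhancedPowerGraph G).universalVerts = {1})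
    {D : Set ↥((enhancedPowerGraph G).universalVertsᶜ)}
    (hD : IsTotalDominatingSet (properEnhancedPowerGraph G) D) :
    ∃ p ∈ (Nat.card G).primeFactors, (numSubgroupsOfOrder p G : ℕ∞) + 1 ≤ D.encard := by
  choose f hf hfp using exists_le_zpowers_card_prime (G := G)
  obtain ⟨p, hp, hpD⟩ := exists_subgroupsOfOrder_subset_image hV hD hf hfp
  have := Fact.mk (Nat.prime_of_mem_primeFactors hp)
  obtain ⟨x, hx⟩ := exists_prime_orderOf_dvd_card' p (Nat.dvd_of_mem_primeFactors hp)
  obtain ⟨v, hv, -⟩ := hpD ((Nat.card_zpowers x).trans hx)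
  obtain ⟨w, hw, hvw⟩ := hD v
  refine ⟨p, hp, ?_⟩
  rw [← encard_subgroupsOfOrder]
  exact encard_add_one_le_of_subset_image hpD hv hw hvw.ne fun hfv hfw =>
    enhancedPowerGraph.eq_of_adj hvw (hf v) (hf w) (hfv.trans hfw.symm)

theorem strongDominationNumber_of_isNilpotent
    (hV : (enhancedPowerGraph G).universalVerts = {1}) (hG : 2 ≤ (Nat.card G).primeFactors.card) :
    strongDominationNumber (properEnhancedPowerGraph G)
      = (⨅ p : (Nat.card G).primeFactors, (numSubgroupsOfOrder (p : ℕ) G : ℕ∞)) + 1 := by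
  have hne : (Nat.card G).primeFactors.Nonempty := Finset.card_pos.mp (by omega)
  have : Nontrivial G :=
    Finite.one_lt_card_iff_nontrivial.mp (Nat.nonempty_primeFactors.mp hne)
  have := hne.to_subtype
  rw [ENat.iInf_add]
  refine le_antisymm (le_iInf fun p => ?_) (le_iInf fun D => ?_)
  · obtain ⟨q, hq, hqp⟩ := Finset.exists_mem_ne hG (p : ℕ)
    have := Fact.mk (Nat.prime_of_mem_primeFactors p.2)
    have := Fact.mk (Nat.prime_of_mem_primeFactors hq)
    exact strongDominationNumber_le_numSubgroupsOfOrder_add_one hV hqp.symm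
      (Nat.dvd_of_mem_primeFactors p.2) (Nat.dvd_of_mem_primeFactors hq)
  · obtain ⟨p, hp, hle⟩ := exists_numSubgroupsOfOrder_add_one_le_encard hV D.2
    exact (iInf_le _ ⟨p, hp⟩).trans hle

end properEnhancedPowerGraph

theorem mainTheorem2 (G : Type*) [Group G] [Finite G] (hG : Group.IsNilpotent G)
    (hSylow : ∀ p ∈ (Nat.card G).primeFactors, ∀ P : Sylow p G,
      ¬ IsCyclic P ∧ ¬ IsGeneralizedQuaternion P) :
    (∀ p : ℕ, p.Prime → IsPGroup p G →
      (∃ D, IsTotalDominatingSet (properEnhancedPowerGraph G) D) →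
        strongDominationNumber (properEnhancedPowerGraph G)
          = 2 * (numSubgroupsOfOrder p G : ℕ∞)) ∧
    (2 ≤ (Nat.card G).primeFactors.card →
      ∀ P : (p : (Nat.card G).primeFactors) → Sylow (p : ℕ) G,
        strongDominationNumber (properEnhancedPowerGraph G)
          = (⨅ p : (Nat.card G).primeFactors, (numSubgroupsOfOrder (p : ℕ) (P p) : ℕ∞)) + 1) := by
  have hV := enhancedPowerGraph.universalVerts_eq_singleton_one hSylow
  refine ⟨fun p hp hpG hD => ?_, fun hm P => ?_⟩
  · have := Fact.mk hp
    exact properEnhancedPowerGraph.strongDominationNumber_of_isPGroup hpG hV hD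
  · have hnum (p : (Nat.card G).primeFactors) :
        numSubgroupsOfOrder (p : ℕ) (P p) = numSubgroupsOfOrder (p : ℕ) G :=
      have := Fact.mk (Nat.prime_of_mem_primeFactors p.2)
      numSubgroupsOfOrder_sylow (P p)
    simp only [hnum]
    exact properEnhancedPowerGraph.strongDominationNumber_of_isNilpotent hV hm
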